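/- Fix $\mu>0$. The data are, for $j=1,2$, real numbers $\alpha_j,\delta_j,\dot\alpha_j,\dot\delta_j$ and vectors $\mathbf q_j,\dot{\mathbf q}_j\in\mathbb R^3$; they form the data space $\mathbb R^{20}$. Put $$\mathbf e^\rho_j=(\cos\delta_j\cos\alpha_j,\cos\delta_j\sin\alpha_j,\sin\delta_j),\quad \mathbf e^\alpha_j=(-\sin\alpha_j,\cos\alpha_j,0),\quad \mathbf e^\delta_j=(-\sin\delta_j\cos\alpha_j,-\sin\delta_j\sin\alpha_j,\cos\delta_j),$$ $$\boldsymbol\eta_j=\dot\alpha_j\cos\delta_j\,\mathbf e^\alpha_j+\dot\delta_j\,\mathbf e^\delta_j .$$ For unknowns $\rho_j,\dot\rho_j,u_j$ ($j=1,2$) with values in $\mathbb C$ put $$\mathbf r_j=\rho_j\mathbf e^\rho_j+\mathbf q_j,\qquad \dot{\mathbf r}_j=\dot\rho_j\mathbf e^\rho_j+\rho_j\boldsymbol\eta_j+\dot{\mathbf q}_j,$$ $$\mathbf c_j=\mathbf r_j\times\dot{\mathbf r}_j,\qquad \mu\mathbf L_j=(|\dot{\mathbf r}_j|^2-u_j)\mathbf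 r_j-(\mathbf r_j\cdot\dot{\mathbf r}_j)\dot{\mathbf r}_j,\qquad \mathcal E_j=\tfrac12|\dot{\mathbf r}_j|^2-u_j,$$ where $\mathbf v\cdot\mathbf w=\sum_i v_iw_i$ and $|\mathbf v|^2=\mathbf v\cdot\mathbf v$ (without complex conjugation). A property is said to hold for generic data if there is a real analytic function $F$ on the data space, not identically zero, such that the property holds for all data at which $F\neq0$. Then for generic data the polynomial system $$\mathbf c_1=\mathbf c_2,\qquad \mu\mathbf L_1=\mu\mathbf L_2,\qquad \mathcal E_1=\mathcal E_2,\qquad u_j^2|\mathbf r_j|^2=\mu^2\quad(j=1,2)$$ in the six unknowns $\rho_1,\rho_2,\dot\rho_1,\dot\rho_2,u_1,u_2$ has no solution in $\mathbb C^6$. Moreover, for each $k\in\{1,2\}$, for generic data the system $$\mathbf c_1=\mathbf c_2,\qquad \mu\mathbf L_1=\mu\mathbf L_2,\qquad \mathcal E_1=\mathcal E_2,\qquad u_k^2|\mathbf r_k|^2=\mu^2$$ has no solution in $\mathbb C^6$. -/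

import Mathlib

open scoped Matrix

/-- The data at one epoch: the attributable `(α, δ, α', δ')` (right ascension, declination and
their rates), the heliocentric position `q` and the heliocentric velocity `q'` of the observer. -/
abbrev EpochData : Type := (Fin 4 → ℝ) × (Fin 3 → ℝ) × (Fin 3 → ℝ)

/-- The data of the linkage problem: the data at the two epochs (indexed by `0` and `1`). -/
abbrev LinkData : Type := Fin 2 → EpochData

namespace EpochData

/-- Right ascension. -/
def α (d : EpochData) : ℝ := d.1 0

/-- Declination. -/
def δ (d : EpochData) : ℝ := d.1 1

/-- Rate of the right ascension. -/
def αdot (d : EpochData) : ℝ := d.1 2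

/-- Rate of the declination. -/
def δdot (d : EpochData) : ℝ := d.1 3

/-- Heliocentric position of the observer. -/
def q (d : EpochData) : Fin 3 → ℝ := d.2.1

/-- Heliocentric velocity of the observer. -/
def qdot (d : EpochData) : Fin 3 → ℝ := d.2.2

/-- The line of sight unit vector `e^ρ`. -/
noncomputable def eρ (d : EpochData) : Fin 3 → ℝ :=
  ![Real.cos d.δ * Real.cos d.α, Real.cos d.δ * Real.sin d.α, Real.sin d.δ]

/-- The unit vector `e^α = (cos δ)⁻¹ ∂e^ρ/∂α`, with the factor `cos δ` cancelled. -/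
noncomputable def eα (d : EpochData) : Fin 3 → ℝ :=
  ![-Real.sin d.α, Real.cos d.α, 0]

/-- The unit vector `e^δ = ∂e^ρ/∂δ`. -/
noncomputable def eδ (d : EpochData) : Fin 3 → ℝ :=
  ![-(Real.sin d.δ * Real.cos d.α), -(Real.sin d.δ * Real.sin d.α), Real.cos d.δ]

/-- The vector `η = α' cos δ e^α + δ' e^δ`, the time derivative of the line of sight. -/
noncomputable def η (d : EpochData) : Fin 3 → ℝ :=
  (d.αdot * Real.cos d.δ) • d.eα + d.δdot • d.eδ

end EpochData

/-- A real vector seen as a complex vector. -/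
def complexify (v : Fin 3 → ℝ) : Fin 3 → ℂ := fun i => (v i : ℂ)

/-- Values in `ℂ` of the six unknowns `ρ_j, ρ'_j, u_j`, `j = 0, 1`. -/
structure LinkUnknowns where
  ρ : Fin 2 → ℂ
  ρdot : Fin 2 → ℂ
  u : Fin 2 → ℂ

namespace LinkUnknowns

/-- Heliocentric position `r_j = ρ_j e^ρ_j + q_j`. -/
noncomputable def r (x : LinkUnknowns) (d : LinkData) (j : Fin 2) : Fin 3 → ℂ :=
  x.ρ j • complexify (d j).eρ + complexify (d j).q

/-- Heliocentric velocity `r'_j = ρ'_j e^ρ_j + ρ_j η_j + q'_j`. -/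
noncomputable def rdot (x : LinkUnknowns) (d : LinkData) (j : Fin 2) : Fin 3 → ℂ :=
  x.ρdot j • complexify (d j).eρ + x.ρ j • complexify (d j).η + complexify (d j).qdot

/-- Angular momentum `c_j = r_j × r'_j`. -/
noncomputable def angMom (x : LinkUnknowns) (d : LinkData) (j : Fin 2) : Fin 3 → ℂ :=
  x.r d j ⨯₃ x.rdot d j

/-- The Laplace-Lenz vector times `μ`, with `u_j` in place of `μ / |r_j|`:
`μ L_j = (|r'_j|² - u_j) r_j - (r_j · r'_j) r'_j`. The product `⬝ᵥ` is bilinear (no complex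
conjugation), so all these expressions are polynomials in the unknowns. -/
noncomputable def lenz (x : LinkUnknowns) (d : LinkData) (j : Fin 2) : Fin 3 → ℂ :=
  (x.rdot d j ⬝ᵥ x.rdot d j - x.u j) • x.r d j - (x.r d j ⬝ᵥ x.rdot d j) • x.rdot d j

/-- The energy, with `u_j` in place of `μ / |r_j|`: `E_j = |r'_j|² / 2 - u_j`. -/
noncomputable def energy (x : LinkUnknowns) (d : LinkData) (j : Fin 2) : ℂ :=
  (1 / 2) * (x.rdot d j ⬝ᵥ x.rdot d j) - x.u j

/-- The seven scalar equations `c_1 = c_2`, `μ L_1 = μ L_2`, `E_1 = E_2`. -/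
def ConservationLaws (x : LinkUnknowns) (d : LinkData) : Prop :=
  x.angMom d 0 = x.angMom d 1 ∧ x.lenz d 0 = x.lenz d 1 ∧ x.energy d 0 = x.energy d 1

/-- The relation `u_j² |r_j|² = μ²` at the epoch `j`. -/
def PotentialRelation (x : LinkUnknowns) (μ : ℝ) (d : LinkData) (j : Fin 2) : Prop :=
  x.u j ^ 2 * (x.r d j ⬝ᵥ x.r d j) = (μ : ℂ) ^ 2

end LinkUnknowns

/-- The full polynomial system is consistent: it has a solution over `ℂ`. -/
def FullSystemConsistent (μ : ℝ) (d : LinkData) : Prop :=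
  ∃ x : LinkUnknowns, x.ConservationLaws d ∧ ∀ j : Fin 2, x.PotentialRelation μ d j

/-- The system in which only the relation `u_j² |r_j|² = μ²` of the epoch `j` is kept
is consistent: it has a solution over `ℂ`. -/
def ReducedSystemConsistent (μ : ℝ) (j : Fin 2) (d : LinkData) : Prop :=
  ∃ x : LinkUnknowns, x.ConservationLaws d ∧ x.PotentialRelation μ d j

/-- A property holds for generic data: it holds outside the zero set of some real analytic
function on the (connected, 20-dimensional) data space that is not identically zero. -/
def ForGenericData (P : LinkData → Prop) : Prop :=
  ∃ F : LinkData → ℝ, AnalyticOnNhd ℝ F Set.univ ∧ (∃ d, F d ≠ 0) ∧ ∀ d, F d ≠ 0 → P d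

/-! The proof is a count of transcendence degrees. Two states in space have 12 coordinates; lying on
a common Keplerian orbit leaves 7 degrees of freedom: 5 for the orbit and one for each position on
it (`SameOrbit.exists_parameters`). With the 8 angles and rates and the 4 values `ρ`, `ρdot`, the
data become algebraic over 19 elements, while they have 20 independent coordinates. So a solution
cannot live over a field in which the data stay algebraically independent
(`Attributable.not_algebraicIndependent_of_sameOrbit`).

Genericity comes from elimination over the domain of analytic functions on the data space. If the
ideal of the equations contained no nonzero constant of this domain, some prime above it would meet
the constants only in 0, and its residue field would hold such a solution. Hence a nonzero analytic
function lies in the ideal, and it vanishes at all data for which the system is solvable. One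
potential relation suffices, since the conservation laws transfer it to the other epoch. -/

section AlgClosedIn

/-! ### Counting parameters through algebraically closed subfields. -/

variable {F L : Type*} [Field F] [Field L] [Algebra F L]

/-- An intermediate field is closed in `L` if it contains all elements of `L` algebraic over it. -/
def IntermediateField.IsClosedIn (K : IntermediateField F L) : Prop :=
  ∀ x : L, IsAlgebraic K x → x ∈ K

namespace IntermediateField.IsClosedIn

variable {K : IntermediateField F L}

/-- The leading coefficient may vanish: a nonzero polynomial is all that is needed. -/
theorem mem_of_quadratic (hK : K.IsClosedIn) {a b c x : L} (ha : a ∈ K) (hb : b ∈ K) (hc : c ∈ K)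
    (h : a * x ^ 2 + b * x + c = 0) (hne : ¬(a = 0 ∧ b = 0 ∧ c = 0)) : x ∈ K := by
  apply hK
  lift a to K using ha
  lift b to K using hb
  lift c to K using hc
  refine ⟨Polynomial.C a * Polynomial.X ^ 2 + Polynomial.C b * Polynomial.X + Polynomial.C c,
    fun h0 => hne ?_, ?_⟩
  · have h2 := congrArg (fun p => p.coeff 2) h0
    have h1 := congrArg (fun p => p.coeff 1) h0
    have h3 := congrArg (fun p => p.coeff 0) h0
    simp [Polynomial.coeff_X, Polynomial.coeff_C] at h1 h2 h3
    simp [h1, h2, h3]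
  · simpa using! h

theorem mem_of_sq_mem (hK : K.IsClosedIn) {x : L} (h : x ^ 2 ∈ K) : x ∈ K :=
  hK.mem_of_quadratic K.one_mem K.zero_mem (K.neg_mem h) (by ring) (by simp)

end IntermediateField.IsClosedIn

theorem IntermediateField.isClosedIn_algebraicClosure_adjoin (s : Set L) :
    ((algebraicClosure (IntermediateField.adjoin F s) L).restrictScalars F).IsClosedIn := by
  intro x hx
  have hx' : IsAlgebraic (algebraicClosure (IntermediateField.adjoin F s) L) x := hx
  exact (mem_algebraicClosure_iff).2 (hx'.restrictScalars (IntermediateField.adjoin F s))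

/-- Taking for `K` the relative algebraic closure of `F(T)` puts each `x i` in the matroid closure
of `T`, and rank bounds the count. With `h` stated for every closed `K`, dimension counts reduce to
membership arguments. -/
theorem AlgebraicIndependent.card_le_of_mem_algebraicClosure {ι : Type*} [Fintype ι] {x : ι → L}
    (hx : AlgebraicIndependent F x) (T : Finset L)
    (h : ∀ K : IntermediateField F L, K.IsClosedIn → (∀ t ∈ T, t ∈ K) → ∀ i, x i ∈ K) :
    Fintype.card ι ≤ T.card := by
  classical
  have hcl : Set.range x ⊆ (AlgebraicIndependent.matroid F L).closure T := by
    rintro _ ⟨i, rfl⟩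
    rw [AlgebraicIndependent.matroid_closure_eq]
    have := h _ (IntermediateField.isClosedIn_algebraicClosure_adjoin (F := F) (T : Set L))
      (fun t ht => ?_) i
    · exact IntermediateField.isAlgebraic_adjoin_iff.1 (mem_algebraicClosure_iff.1 this)
    · exact mem_algebraicClosure_iff.2 (isAlgebraic_algebraMap
        (⟨t, IntermediateField.subset_adjoin F _ ht⟩ : IntermediateField.adjoin F (T : Set L)))
  have hind : (AlgebraicIndependent.matroid F L).Indep (Set.range x) :=
    AlgebraicIndependent.matroid_indep_iff.2 hx.to_subtype_range
  have h1 := hind.encard_le_eRk_of_subset hcl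
  rw [Matroid.eRk_closure_eq] at h1
  have h2 := h1.trans (Matroid.eRk_le_encard _ _)
  rw [← Set.image_univ, hx.injective.encard_image, Set.encard_univ, Set.encard_coe_eq_coe_finsetCard]
    at h2
  simpa using h2

end AlgClosedIn

/-! ### Vectors and conics over a closed subfield. -/

section TwoBody

variable {F L : Type*} [Field F] [Field L] [Algebra F L]

theorem Fin.forall_fin_three_mem {K : IntermediateField F L} {w : Fin 3 → L} (h0 : w 0 ∈ K)
    (h1 : w 1 ∈ K) (h2 : w 2 ∈ K) (i : Fin 3) : w i ∈ K := by
  fin_cases i <;> assumption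

namespace IntermediateField

variable {K : IntermediateField F L}

theorem dotProduct_mem {v w : Fin 3 → L} (hv : ∀ i, v i ∈ K) (hw : ∀ i, w i ∈ K) :
    v ⬝ᵥ w ∈ K :=
  sum_mem fun i _ => mul_mem (hv i) (hw i)

theorem crossProduct_mem {v w : Fin 3 → L} (hv : ∀ i, v i ∈ K) (hw : ∀ i, w i ∈ K) (i : Fin 3) :
    (v ⨯₃ w) i ∈ K := by
  rw [cross_apply]
  fin_cases i
  · exact sub_mem (mul_mem (hv 1) (hw 2)) (mul_mem (hv 2) (hw 1))
  · exact sub_mem (mul_mem (hv 2) (hw 0)) (mul_mem (hv 0) (hw 2))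
  · exact sub_mem (mul_mem (hv 0) (hw 1)) (mul_mem (hv 1) (hw 0))

theorem mem_of_mul_mem {a b : L} (ha : a ∈ K) (h0 : a ≠ 0) (hab : a * b ∈ K) : b ∈ K := by
  have := div_mem hab ha
  rwa [mul_div_cancel_left₀ b h0] at this

/-- A vector orthogonal to `c ≠ 0` is determined by two of its coordinates. -/
theorem exists_coordinates_of_orthogonal {c : Fin 3 → L} (hc : c ≠ 0) :
    ∃ i j : Fin 3, ∀ K : IntermediateField F L, (∀ i, c i ∈ K) → ∀ w : Fin 3 → L, c ⬝ᵥ w = 0 →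
      w i ∈ K → w j ∈ K → ∀ i, w i ∈ K := by
  obtain ⟨k, hk⟩ : ∃ k, c k ≠ 0 := Function.ne_iff.1 hc
  have key : ∀ (K : IntermediateField F L), (∀ i, c i ∈ K) → ∀ w : Fin 3 → L, c ⬝ᵥ w = 0 →
      (∀ i, i ≠ k → w i ∈ K) → w k ∈ K := by
    intro K hcK w hw hi
    refine mem_of_mul_mem (hcK k) hk ?_
    rw [dotProduct, ← Finset.add_sum_erase _ _ (Finset.mem_univ k)] at hw
    rw [eq_neg_of_add_eq_zero_left hw]
    exact neg_mem (sum_mem fun i h => mul_mem (hcK i) (hi i (Finset.ne_of_mem_erase h)))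
  have : ∀ k : Fin 3, ∃ i j : Fin 3, ∀ l, l = i ∨ l = j ∨ l = k := by decide
  obtain ⟨i, j, hij⟩ := this k
  refine ⟨i, j, fun K hcK w hw hi hj => ?_⟩
  have hwk : w k ∈ K := key K hcK w hw fun l hl => by
    rcases hij l with rfl | rfl | rfl
    exacts [hi, hj, absurd rfl hl]
  intro l
  rcases hij l with rfl | rfl | rfl
  exacts [hi, hj, hwk]

/-- A point of a plane conic that avoids the origin is determined by one of its coordinates. -/
theorem exists_coordinate_of_conic {a b c d e f x y : L} (ha : a ≠ 0)
    (h : a + b * x + c * y + d * x ^ 2 + e * (x * y) + f * y ^ 2 = 0) :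
    ∃ t, (t = x ∨ t = y) ∧ ∀ K : IntermediateField F L, K.IsClosedIn → a ∈ K → b ∈ K → c ∈ K →
      d ∈ K → e ∈ K → f ∈ K → t ∈ K → x ∈ K ∧ y ∈ K := by
  -- The equation is read as a quadratic in `y`. If it degenerates at this `x`, then `x` is a root
  -- of `a + b * x + d * x ^ 2`, nonzero because `a ≠ 0`, and `y` serves as the parameter.
  by_cases h0 : f = 0 ∧ c + e * x = 0 ∧ a + b * x + d * x ^ 2 = 0
  · refine ⟨y, Or.inr rfl, fun K hK haK hbK hcK hdK heK hfK hy => ⟨?_, hy⟩⟩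
    exact hK.mem_of_quadratic hdK hbK haK (by linear_combination h0.2.2) fun h => ha h.2.2
  · refine ⟨x, Or.inl rfl, fun K hK haK hbK hcK hdK heK hfK hx => ⟨hx, ?_⟩⟩
    exact hK.mem_of_quadratic hfK (add_mem hcK (mul_mem heK hx))
      (add_mem (add_mem haK (mul_mem hbK hx)) (mul_mem hdK (pow_mem hx 2)))
      (by linear_combination h) h0

/-- Multiplying by `c₃ ^ 2` and eliminating `z` by orthogonality gives a conic in `x`, `y` with
constant term `(c₃ * n) ^ 2 ≠ 0`. -/
theorem exists_coordinate_of_planeConic_aux {m c₁ c₂ c₃ a₁ a₂ a₃ x y z : L} (hc₃ : c₃ ≠ 0)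
    (hn : c₁ * c₁ + c₂ * c₂ + c₃ * c₃ ≠ 0) (ho : c₁ * x + c₂ * y + c₃ * z = 0)
    (h : (c₁ * c₁ + c₂ * c₂ + c₃ * c₃ - (a₁ * x + a₂ * y + a₃ * z)) ^ 2 =
      m * (x * x + y * y + z * z)) :
    ∃ t, (t = x ∨ t = y) ∧ ∀ K : IntermediateField F L, K.IsClosedIn → m ∈ K → c₁ ∈ K → c₂ ∈ K →
      c₃ ∈ K → a₁ ∈ K → a₂ ∈ K → a₃ ∈ K → t ∈ K → x ∈ K ∧ y ∈ K ∧ z ∈ K := by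
  set n := c₁ * c₁ + c₂ * c₂ + c₃ * c₃ with hnd
  set p := a₁ * c₃ - a₃ * c₁ with hp
  set q := a₂ * c₃ - a₃ * c₂ with hq
  obtain ⟨t, ht, hK⟩ := exists_coordinate_of_conic (F := F) (a := (c₃ * n) ^ 2)
    (b := -(2 * (c₃ * n * p))) (c := -(2 * (c₃ * n * q)))
    (d := p ^ 2 - m * (c₃ ^ 2 + c₁ ^ 2)) (e := 2 * (p * q) - m * (2 * (c₁ * c₂)))
    (f := q ^ 2 - m * (c₃ ^ 2 + c₂ ^ 2)) (x := x) (y := y)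
    (pow_ne_zero 2 (mul_ne_zero hc₃ hn)) (by
      have hz : c₃ * z = -(c₁ * x + c₂ * y) := by linear_combination ho
      have e1 : c₃ * (n - (a₁ * x + a₂ * y + a₃ * z)) = c₃ * n - (p * x + q * y) := by
        rw [hp, hq]; linear_combination -a₃ * hz
      have e2 : c₃ ^ 2 * (m * (x * x + y * y + z * z)) =
          m * (c₃ ^ 2 * x ^ 2 + c₃ ^ 2 * y ^ 2 + (c₁ * x + c₂ * y) ^ 2) := by
        linear_combination m * (c₃ * z - (c₁ * x + c₂ * y)) * hz
      have e3 : (c₃ * n - (p * x + q * y)) ^ 2 =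
          m * (c₃ ^ 2 * x ^ 2 + c₃ ^ 2 * y ^ 2 + (c₁ * x + c₂ * y) ^ 2) := by
        rw [← e1, ← e2, mul_pow, h]
      linear_combination e3)
  refine ⟨t, ht, fun K hKc hm h1 h2 h3 h4 h5 h6 htK => ?_⟩
  have hnK : n ∈ K := add_mem (add_mem (mul_mem h1 h1) (mul_mem h2 h2)) (mul_mem h3 h3)
  have hpK : p ∈ K := sub_mem (mul_mem h4 h3) (mul_mem h6 h1)
  have hqK : q ∈ K := sub_mem (mul_mem h5 h3) (mul_mem h6 h2)
  have two : (2 : L) ∈ K := ofNat_mem K 2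
  have hcn := mul_mem h3 hnK
  obtain ⟨hx, hy⟩ := hK K hKc (pow_mem hcn 2) (neg_mem (mul_mem two (mul_mem hcn hpK)))
    (neg_mem (mul_mem two (mul_mem hcn hqK)))
    (sub_mem (pow_mem hpK 2) (mul_mem hm (add_mem (pow_mem h3 2) (pow_mem h1 2))))
    (sub_mem (mul_mem two (mul_mem hpK hqK)) (mul_mem hm (mul_mem two (mul_mem h1 h2))))
    (sub_mem (pow_mem hqK 2) (mul_mem hm (add_mem (pow_mem h3 2) (pow_mem h2 2)))) htK
  refine ⟨hx, hy, mem_of_mul_mem h3 hc₃ ?_⟩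
  rw [eq_neg_of_add_eq_zero_right ho]
  exact neg_mem (add_mem (mul_mem h1 hx) (mul_mem h2 hy))

theorem exists_coordinate_of_planeConic {m : L} {c a w : Fin 3 → L} (hn : c ⬝ᵥ c ≠ 0)
    (ho : c ⬝ᵥ w = 0) (h : (c ⬝ᵥ c - a ⬝ᵥ w) ^ 2 = m * (w ⬝ᵥ w)) :
    ∃ t : L, ∀ K : IntermediateField F L, K.IsClosedIn → m ∈ K → (∀ i, c i ∈ K) →
      (∀ i, a i ∈ K) → t ∈ K → ∀ i, w i ∈ K := by
  obtain ⟨k, hk⟩ : ∃ k, c k ≠ 0 := Function.ne_iff.1 fun h : c = 0 => hn (by simp [h])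
  simp only [dotProduct, Fin.sum_univ_three] at hn ho h
  fin_cases k
  · obtain ⟨t, -, ht⟩ := exists_coordinate_of_planeConic_aux (F := F) (m := m) (c₁ := c 1)
      (c₂ := c 2) (a₁ := a 1) (a₂ := a 2) (a₃ := a 0) (x := w 1) (y := w 2) (z := w 0) hk
      (by convert hn using 1; simp; ring) (by simp; linear_combination ho)
      (by simp; linear_combination h)
    refine ⟨t, fun K hK hm hc ha htK => ?_⟩
    obtain ⟨h1, h2, h3⟩ := ht K hK hm (hc _) (hc _) (hc _) (ha _) (ha _) (ha _) htK
    exact Fin.forall_fin_three_mem h3 h1 h2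
  · obtain ⟨t, -, ht⟩ := exists_coordinate_of_planeConic_aux (F := F) (m := m) (c₁ := c 0)
      (c₂ := c 2) (a₁ := a 0) (a₂ := a 2) (a₃ := a 1) (x := w 0) (y := w 2) (z := w 1) hk
      (by convert hn using 1; simp; ring) (by simp; linear_combination ho)
      (by simp; linear_combination h)
    refine ⟨t, fun K hK hm hc ha htK => ?_⟩
    obtain ⟨h1, h2, h3⟩ := ht K hK hm (hc _) (hc _) (hc _) (ha _) (ha _) (ha _) htK
    exact Fin.forall_fin_three_mem h1 h3 h2
  · obtain ⟨t, -, ht⟩ := exists_coordinate_of_planeConic_aux (F := F) (m := m) (c₁ := c 0)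
      (c₂ := c 1) (a₁ := a 0) (a₂ := a 1) (a₃ := a 2) (x := w 0) (y := w 1) (z := w 2) hk hn ho h
    refine ⟨t, fun K hK hm hc ha htK => ?_⟩
    obtain ⟨h1, h2, h3⟩ := ht K hK hm (hc _) (hc _) (hc _) (ha _) (ha _) (ha _) htK
    exact Fin.forall_fin_three_mem h1 h2 h3

theorem velocity_mem {r v : Fin 3 → L} (h0 : r ⬝ᵥ r ≠ 0) (hr : ∀ i, r i ∈ K)
    (hc : ∀ i, (r ⨯₃ v) i ∈ K) (hs : r ⬝ᵥ v ∈ K) (i : Fin 3) : v i ∈ K := by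
  have key : (r ⬝ᵥ r) * v i = (r ⬝ᵥ v) * r i - (r ⨯₃ (r ⨯₃ v)) i := by
    fin_cases i <;> simp [cross_apply, dotProduct, Fin.sum_univ_three] <;> ring
  exact mem_of_mul_mem (dotProduct_mem hr hr) h0
    (key ▸ sub_mem (mul_mem hs (hr i)) (crossProduct_mem hr hc i))

end IntermediateField
end TwoBody

theorem Finset.card_le_seven {α : Type*} [DecidableEq α] {a b c d e f g : α} :
    ({a, b, c, d, e, f, g} : Finset α).card ≤ 7 :=
  (Finset.card_insert_le _ _).trans (Nat.succ_le_succ Finset.card_le_six)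

/-! ### Identities between the Keplerian integrals. -/

section Kepler

variable {R : Type*} [CommRing R]

/-- The Laplace-Lenz vector (times the gravitational parameter) of the state `(r, v)`, with `u` in
place of the potential. -/
def lenzVector (r v : Fin 3 → R) (u : R) : Fin 3 → R :=
  (v ⬝ᵥ v - u) • r - (r ⬝ᵥ v) • v

theorem lenzVector_dotProduct_self (r v : Fin 3 → R) (u : R) :
    lenzVector r v u ⬝ᵥ lenzVector r v u =
      u ^ 2 * (r ⬝ᵥ r) + (v ⬝ᵥ v - 2 * u) * ((r ⨯₃ v) ⬝ᵥ (r ⨯₃ v)) := by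
  simp only [lenzVector, dotProduct, Fin.sum_univ_three, cross_apply, Pi.sub_apply, Pi.smul_apply,
    smul_eq_mul, Matrix.cons_val]
  ring

theorem lenzVector_dotProduct (r v : Fin 3 → R) (u : R) :
    lenzVector r v u ⬝ᵥ r = (r ⨯₃ v) ⬝ᵥ (r ⨯₃ v) - u * (r ⬝ᵥ r) := by
  simp only [lenzVector, dotProduct, Fin.sum_univ_three, cross_apply, Pi.sub_apply, Pi.smul_apply,
    smul_eq_mul, Matrix.cons_val]
  ring

theorem sq_dotProduct_eq (r v : Fin 3 → R) :
    (r ⬝ᵥ v) ^ 2 = (r ⬝ᵥ r) * (v ⬝ᵥ v) - (r ⨯₃ v) ⬝ᵥ (r ⨯₃ v) := by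
  simp only [dotProduct, Fin.sum_univ_three, cross_apply, Matrix.cons_val]
  ring

theorem cross_dotProduct_left (r v : Fin 3 → R) : (r ⨯₃ v) ⬝ᵥ r = 0 := by
  rw [dotProduct_comm, dot_self_cross]

end Kepler

/-! ### Pairs of states on one orbit: seven parameters. -/

section SameOrbit

variable {F L : Type*} [Field F] [Field L] [Algebra F L]

/-- The states `(r 0, v 0)` and `(r 1, v 1)` have the same Keplerian integrals, with `u j` in place
of the potentials; `m` is the gravitational parameter. -/
structure SameOrbit {R : Type*} [CommRing R] (m : R) (r v : Fin 2 → Fin 3 → R) (u : Fin 2 → R) :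
    Prop where
  angMom : r 0 ⨯₃ v 0 = r 1 ⨯₃ v 1
  lenz : lenzVector (r 0) (v 0) (u 0) = lenzVector (r 1) (v 1) (u 1)
  energy : v 0 ⬝ᵥ v 0 - 2 * u 0 = v 1 ⬝ᵥ v 1 - 2 * u 1
  potential : ∀ j, u j ^ 2 * (r j ⬝ᵥ r j) = m ^ 2

/-- By `lenzVector_dotProduct_self`, `u ^ 2 * (r ⬝ᵥ r)` is a function of the conserved quantities,
so it agrees at both epochs. -/
theorem SameOrbit.of_potential {R : Type*} [CommRing R] {m : R} {r v : Fin 2 → Fin 3 → R}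
    {u : Fin 2 → R} (hc : r 0 ⨯₃ v 0 = r 1 ⨯₃ v 1)
    (hA : lenzVector (r 0) (v 0) (u 0) = lenzVector (r 1) (v 1) (u 1))
    (hE : v 0 ⬝ᵥ v 0 - 2 * u 0 = v 1 ⬝ᵥ v 1 - 2 * u 1) (k : Fin 2)
    (hk : u k ^ 2 * (r k ⬝ᵥ r k) = m ^ 2) : SameOrbit m r v u := by
  have h : u 0 ^ 2 * (r 0 ⬝ᵥ r 0) = u 1 ^ 2 * (r 1 ⬝ᵥ r 1) := by
    have h0 := lenzVector_dotProduct_self (r 0) (v 0) (u 0)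
    have h1 := lenzVector_dotProduct_self (r 1) (v 1) (u 1)
    rw [hA, hc, hE] at h0
    exact add_right_cancel (h0.symm.trans h1)
  refine ⟨hc, hA, hE, ?_⟩
  rw [Fin.forall_fin_two]
  fin_cases k
  · exact ⟨hk, h ▸ hk⟩
  · exact ⟨h ▸ hk, hk⟩

namespace SameOrbit

variable {m : F} {r v : Fin 2 → Fin 3 → L} {u : Fin 2 → L}

theorem dotProduct_ne_zero (h : SameOrbit (algebraMap F L m) r v u) (hm : m ≠ 0) (j : Fin 2) :
    r j ⬝ᵥ r j ≠ 0 := fun h0 => by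
  have := h.potential j
  rw [h0, mul_zero, eq_comm] at this
  exact hm ((map_eq_zero _).1 (pow_eq_zero_iff two_ne_zero |>.1 this))

theorem potential_mem {K : IntermediateField F L} (h : SameOrbit (algebraMap F L m) r v u)
    (hm : m ≠ 0) (hK : K.IsClosedIn) {j : Fin 2} (hr : ∀ i, r j i ∈ K) : u j ∈ K := by
  refine hK.mem_of_sq_mem (IntermediateField.mem_of_mul_mem
    (IntermediateField.dotProduct_mem hr hr) (h.dotProduct_ne_zero hm j) ?_)
  rw [mul_comm, h.potential j]
  exact pow_mem (K.algebraMap_mem m) 2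

/-- Two states on the same orbit are determined, up to finitely many choices, by the positions,
the angular momentum and the radial component of the first velocity. -/
theorem velocity_mem {K : IntermediateField F L} (h : SameOrbit (algebraMap F L m) r v u)
    (hm : m ≠ 0) (hK : K.IsClosedIn) (hr : ∀ j i, r j i ∈ K) (hc : ∀ i, (r 0 ⨯₃ v 0) i ∈ K)
    (hs : r 0 ⬝ᵥ v 0 ∈ K) (j : Fin 2) (i : Fin 3) : v j i ∈ K := by
  have hv0 := IntermediateField.velocity_mem (h.dotProduct_ne_zero hm 0) (hr 0) hc hs
  have hu := fun j => h.potential_mem hm hK (hr j)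
  have two : (2 : L) ∈ K := ofNat_mem K 2
  have hv1 : v 1 ⬝ᵥ v 1 ∈ K := by
    have := h.energy
    rw [show v 1 ⬝ᵥ v 1 = v 0 ⬝ᵥ v 0 - 2 * u 0 + 2 * u 1 by linear_combination -this]
    exact add_mem (sub_mem (IntermediateField.dotProduct_mem hv0 hv0) (mul_mem two (hu 0)))
      (mul_mem two (hu 1))
  -- Energy fixes the squared speed, and Lagrange's identity then fixes `r 1 ⬝ᵥ v 1` up to sign.
  have hs1 : r 1 ⬝ᵥ v 1 ∈ K := by
    refine hK.mem_of_sq_mem ?_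
    rw [sq_dotProduct_eq, ← h.angMom]
    exact sub_mem (mul_mem (IntermediateField.dotProduct_mem (hr 1) (hr 1)) hv1)
      (IntermediateField.dotProduct_mem hc hc)
  have hv1 := IntermediateField.velocity_mem (h.dotProduct_ne_zero hm 1) (hr 1) (h.angMom ▸ hc) hs1
  revert i
  exact (Fin.forall_fin_two (p := fun j => ∀ i, v j i ∈ K)).2 ⟨hv0, hv1⟩ j

/-- The pairs of states on the same orbit form a family with at most seven parameters. -/
theorem exists_parameters (h : SameOrbit (algebraMap F L m) r v u) (hm : m ≠ 0) :
    ∃ T : Finset L, T.card ≤ 7 ∧ ∀ K : IntermediateField F L, K.IsClosedIn → (∀ t ∈ T, t ∈ K) →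
      ∀ j i, r j i ∈ K ∧ v j i ∈ K := by
  classical
  set c := r 0 ⨯₃ v 0 with hcd
  have ho : ∀ j, c ⬝ᵥ r j = 0 := by
    rw [Fin.forall_fin_two]
    exact ⟨cross_dotProduct_left _ _, hcd ▸ h.angMom ▸ cross_dotProduct_left _ _⟩
  suffices H : ∃ T : Finset L, T.card ≤ 7 ∧ ∀ K : IntermediateField F L, K.IsClosedIn →
      (∀ t ∈ T, t ∈ K) → (∀ i, r 0 i ∈ K) ∧ (∀ i, r 1 i ∈ K) ∧ (∀ i, c i ∈ K) ∧
        r 0 ⬝ᵥ v 0 ∈ K by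
    obtain ⟨T, hT, H⟩ := H
    refine ⟨T, hT, fun K hK hTK => ?_⟩
    obtain ⟨h1, h2, h3, h4⟩ := H K hK hTK
    have hr : ∀ j i, r j i ∈ K := Fin.forall_fin_two.2 ⟨h1, h2⟩
    exact fun j i => ⟨hr j i, h.velocity_mem hm hK hr h3 h4 j i⟩
  -- Rectilinear motion: the angular momentum costs nothing, so both positions may be free, leaving
  -- one parameter for the radial velocity.
  by_cases hc : c = 0
  · refine ⟨{r 0 0, r 0 1, r 0 2, r 1 0, r 1 1, r 1 2, r 0 ⬝ᵥ v 0}, Finset.card_le_seven, ?_⟩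
    intro K hK hT
    simp only [Finset.mem_insert, Finset.mem_singleton, forall_eq_or_imp, forall_eq] at hT
    obtain ⟨h1, h2, h3, h4, h5, h6, h7⟩ := hT
    exact ⟨Fin.forall_fin_three_mem h1 h2 h3, Fin.forall_fin_three_mem h4 h5 h6,
      fun i => by simp [hc], h7⟩
  obtain ⟨a, b, hab⟩ := IntermediateField.exists_coordinates_of_orthogonal (F := F) hc
  -- A nonzero isotropic `c` has only two free coordinates, which pays for two free coordinates of
  -- each position in the plane orthogonal to `c`.
  by_cases hn : c ⬝ᵥ c = 0
  · refine ⟨{c 0, c 1, r 0 a, r 0 b, r 1 a, r 1 b, r 0 ⬝ᵥ v 0}, Finset.card_le_seven, ?_⟩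
    intro K hK hT
    simp only [Finset.mem_insert, Finset.mem_singleton, forall_eq_or_imp, forall_eq] at hT
    obtain ⟨h1, h2, h3, h4, h5, h6, h7⟩ := hT
    have hc2 : c 2 ∈ K := by
      refine hK.mem_of_sq_mem ?_
      rw [dotProduct, Fin.sum_univ_three] at hn
      rw [show c 2 ^ 2 = -(c 0 * c 0 + c 1 * c 1) by linear_combination hn]
      exact neg_mem (add_mem (mul_mem h1 h1) (mul_mem h2 h2))
    have hcK := Fin.forall_fin_three_mem h1 h2 hc2
    exact ⟨hab K hcK _ (ho 0) h3 h4, hab K hcK _ (ho 1) h5 h6, hcK, h7⟩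
  -- In the main case the first state takes six parameters and fixes the orbit; `r 1` lies on its
  -- conic and adds one.
  · have hconic : (c ⬝ᵥ c - lenzVector (r 0) (v 0) (u 0) ⬝ᵥ r 1) ^ 2 =
        algebraMap F L m ^ 2 * (r 1 ⬝ᵥ r 1) := by
      rw [h.lenz, lenzVector_dotProduct, hcd, h.angMom, ← h.potential 1]
      ring
    obtain ⟨t, ht⟩ := IntermediateField.exists_coordinate_of_planeConic (F := F) hn (ho 1) hconic
    refine ⟨{c 0, c 1, c 2, r 0 a, r 0 b, t, r 0 ⬝ᵥ v 0}, Finset.card_le_seven, ?_⟩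
    intro K hK hT
    simp only [Finset.mem_insert, Finset.mem_singleton, forall_eq_or_imp, forall_eq] at hT
    obtain ⟨h1, h2, h3, h4, h5, h6, h7⟩ := hT
    have hcK := Fin.forall_fin_three_mem h1 h2 h3
    have hr0 := hab K hcK _ (ho 0) h4 h5
    have hv0 := IntermediateField.velocity_mem (h.dotProduct_ne_zero hm 0) hr0 hcK h7
    refine ⟨hr0, ht K hK (pow_mem (K.algebraMap_mem m) 2) hcK (fun i => ?_) h6, hcK, h7⟩
    exact sub_mem (mul_mem (sub_mem (IntermediateField.dotProduct_mem hv0 hv0)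
      (h.potential_mem hm hK hr0)) (hr0 i)) (mul_mem h7 (hv0 i))

end SameOrbit
end SameOrbit

/-! ### Observational data over a ring, and the count 19 < 20. -/

/-- The data of one epoch over a ring, with the right ascension and the declination given by their
cosines and sines. -/
structure Attributable (R : Type*) where
  cosα : R
  sinα : R
  cosδ : R
  sinδ : R
  αdot : R
  δdot : R
  q : Fin 3 → R
  qdot : Fin 3 → R

namespace Attributable

section Ring

variable {R S : Type*} [CommRing R] [CommRing S]

def map (f : R →+* S) (D : Attributable R) : Attributable S where
  cosα := f D.cosα
  sinα := f D.sinα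
  cosδ := f D.cosδ
  sinδ := f D.sinδ
  αdot := f D.αdot
  δdot := f D.δdot
  q i := f (D.q i)
  qdot i := f (D.qdot i)

def eρ (D : Attributable R) : Fin 3 → R :=
  ![D.cosδ * D.cosα, D.cosδ * D.sinα, D.sinδ]

def η (D : Attributable R) : Fin 3 → R :=
  ![-(D.αdot * D.cosδ * D.sinα) - D.δdot * (D.sinδ * D.cosα),
    D.αdot * D.cosδ * D.cosα - D.δdot * (D.sinδ * D.sinα), D.δdot * D.cosδ]

/-- Position at distance `ρ` on the line of sight. -/
def pos (D : Attributable R) (ρ : R) : Fin 3 → R :=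
  fun i => ρ * D.eρ i + D.q i

/-- Velocity at distance `ρ` with radial velocity `ρdot`. -/
def vel (D : Attributable R) (ρ ρdot : R) : Fin 3 → R :=
  fun i => ρdot * D.eρ i + ρ * D.η i + D.qdot i

theorem map_eρ (f : R →+* S) (D : Attributable R) (i : Fin 3) :
    (D.map f).eρ i = f (D.eρ i) := by
  fin_cases i <;> simp [eρ, map]

theorem map_η (f : R →+* S) (D : Attributable R) (i : Fin 3) :
    (D.map f).η i = f (D.η i) := by
  fin_cases i <;> simp [η, map]

theorem comp_pos (f : R →+* S) (D : Attributable R) (ρ : R) :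
    f ∘ D.pos ρ = (D.map f).pos (f ρ) := by
  funext i
  simp only [Function.comp_apply, pos, map_eρ, map_add, map_mul]
  rfl

theorem comp_vel (f : R →+* S) (D : Attributable R) (ρ ρdot : R) :
    f ∘ D.vel ρ ρdot = (D.map f).vel (f ρ) (f ρdot) := by
  funext i
  simp only [Function.comp_apply, vel, map_eρ, map_η, map_add, map_mul]
  rfl

/-- The coordinates of a pair of attributables that determine it up to the signs of the cosines. -/
def coordinates (D : Fin 2 → Attributable R) : Fin 2 × (Fin 4 ⊕ Fin 3 ⊕ Fin 3) → R :=
  fun p => Sum.elim ![(D p.1).sinα, (D p.1).sinδ, (D p.1).αdot, (D p.1).δdot]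
    (Sum.elim (D p.1).q (D p.1).qdot) p.2

theorem coordinates_map (f : R →+* S) (D : Fin 2 → Attributable R) :
    coordinates (fun j => (D j).map f) = f ∘ coordinates D := by
  funext p
  obtain ⟨j, i | i | i⟩ := p
  · fin_cases i <;> rfl
  · rfl
  · rfl

end Ring

section Field

variable {F L : Type*} [Field F] [Field L] [Algebra F L]

/-- Two states seen from data with algebraically independent coordinates are not on the same
orbit. -/
theorem not_algebraicIndependent_of_sameOrbit {m : F} (hm : m ≠ 0) {D : Fin 2 → Attributable L}
    (hα : ∀ j, (D j).cosα ^ 2 + (D j).sinα ^ 2 = 1) (hδ : ∀ j, (D j).cosδ ^ 2 + (D j).sinδ ^ 2 = 1)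
    {ρ ρdot u : Fin 2 → L}
    (h : SameOrbit (algebraMap F L m) (fun j => (D j).pos (ρ j))
      (fun j => (D j).vel (ρ j) (ρdot j)) u) :
    ¬ AlgebraicIndependent F (coordinates D) := by
  classical
  intro hind
  obtain ⟨T, hT, H⟩ := h.exists_parameters hm
  -- These 12 elements and the 7 of `T` determine the states and lines of sight up to finitely many
  -- choices; `q` and `qdot` follow by subtraction.
  let angles : Fin 2 × Fin 6 → L := fun p =>
    ![(D p.1).sinα, (D p.1).sinδ, (D p.1).αdot, (D p.1).δdot, ρ p.1, ρdot p.1] p.2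
  have hcard := hind.card_le_of_mem_algebraicClosure (T ∪ Finset.univ.image angles) ?_
  · have h1 := Finset.card_union_le T (Finset.univ.image angles)
    have h2 := Finset.card_image_le (s := Finset.univ) (f := angles)
    simp at h2 hcard
    omega
  intro K hK hTK
  have hst := H K hK fun t ht => hTK t (Finset.mem_union_left _ ht)
  have hang : ∀ j i, angles (j, i) ∈ K := fun j i =>
    hTK _ (Finset.mem_union_right _ (Finset.mem_image_of_mem _ (Finset.mem_univ _)))
  have hsα : ∀ j, (D j).sinα ∈ K := fun j => hang j 0
  have hsδ : ∀ j, (D j).sinδ ∈ K := fun j => hang j 1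
  have hαd : ∀ j, (D j).αdot ∈ K := fun j => hang j 2
  have hδd : ∀ j, (D j).δdot ∈ K := fun j => hang j 3
  have hρ : ∀ j, ρ j ∈ K := fun j => hang j 4
  have hρd : ∀ j, ρdot j ∈ K := fun j => hang j 5
  have hcα : ∀ j, (D j).cosα ∈ K := fun j => by
    refine hK.mem_of_sq_mem ?_
    rw [eq_sub_of_add_eq (hα j)]
    exact sub_mem K.one_mem (pow_mem (hsα j) 2)
  have hcδ : ∀ j, (D j).cosδ ∈ K := fun j => by
    refine hK.mem_of_sq_mem ?_
    rw [eq_sub_of_add_eq (hδ j)]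
    exact sub_mem K.one_mem (pow_mem (hsδ j) 2)
  have heρ : ∀ j i, (D j).eρ i ∈ K := fun j => Fin.forall_fin_three_mem
    (mul_mem (hcδ j) (hcα j)) (mul_mem (hcδ j) (hsα j)) (hsδ j)
  have hη : ∀ j i, (D j).η i ∈ K := fun j => Fin.forall_fin_three_mem
    (sub_mem (neg_mem (mul_mem (mul_mem (hαd j) (hcδ j)) (hsα j)))
      (mul_mem (hδd j) (mul_mem (hsδ j) (hcα j))))
    (sub_mem (mul_mem (mul_mem (hαd j) (hcδ j)) (hcα j))
      (mul_mem (hδd j) (mul_mem (hsδ j) (hsα j))))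
    (mul_mem (hδd j) (hcδ j))
  rintro ⟨j, i | i | i⟩
  · fin_cases i
    exacts [hsα j, hsδ j, hαd j, hδd j]
  · have h1 : (D j).q i = (D j).pos (ρ j) i - ρ j * (D j).eρ i := by simp [pos]
    change (D j).q i ∈ K
    exact h1 ▸ sub_mem (hst j i).1 (mul_mem (hρ j) (heρ j i))
  · have h1 : (D j).qdot i =
        (D j).vel (ρ j) (ρdot j) i - (ρdot j * (D j).eρ i + ρ j * (D j).η i) := by simp [vel]
    change (D j).qdot i ∈ K
    exact h1 ▸ sub_mem (hst j i).2
      (add_mem (mul_mem (hρd j) (heρ j i)) (mul_mem (hρ j) (hη j i)))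

end Field

end Attributable

/-! ### Elimination of the unknowns over a domain of data. -/

section Elimination

/-- The polynomials whose vanishing expresses that two states have the same Keplerian integrals,
with the relation for the potential kept at the epoch `k` only. -/
def orbitRelations {R : Type*} [CommRing R] (m : R) (r v : Fin 2 → Fin 3 → R) (u : Fin 2 → R)
    (k : Fin 2) : Set R :=
  Set.range (r 0 ⨯₃ v 0 - r 1 ⨯₃ v 1) ∪
    Set.range (lenzVector (r 0) (v 0) (u 0) - lenzVector (r 1) (v 1) (u 1)) ∪
    {v 0 ⬝ᵥ v 0 - 2 * u 0 - (v 1 ⬝ᵥ v 1 - 2 * u 1), u k ^ 2 * (r k ⬝ᵥ r k) - m ^ 2}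

theorem map_crossProduct_apply {R S : Type*} [CommRing R] [CommRing S] (f : R →+* S)
    (v w : Fin 3 → R) (i : Fin 3) : f ((v ⨯₃ w) i) = ((f ∘ v) ⨯₃ (f ∘ w)) i := by
  fin_cases i <;> simp [cross_apply]

theorem map_lenzVector_apply {R S : Type*} [CommRing R] [CommRing S] (f : R →+* S)
    (r v : Fin 3 → R) (u : R) (i : Fin 3) :
    f (lenzVector r v u i) = lenzVector (f ∘ r) (f ∘ v) (f u) i := by
  simp [lenzVector, RingHom.map_dotProduct]

theorem forall_orbitRelations_map_eq_zero_iff {R S : Type*} [CommRing R] [CommRing S] (f : R →+* S)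
    {m : R} {r v : Fin 2 → Fin 3 → R} {u : Fin 2 → R} {k : Fin 2} :
    (∀ p ∈ orbitRelations m r v u k, f p = 0) ↔
      (f ∘ r 0) ⨯₃ (f ∘ v 0) = (f ∘ r 1) ⨯₃ (f ∘ v 1) ∧
      lenzVector (f ∘ r 0) (f ∘ v 0) (f (u 0)) = lenzVector (f ∘ r 1) (f ∘ v 1) (f (u 1)) ∧
      (f ∘ v 0) ⬝ᵥ (f ∘ v 0) - 2 * f (u 0) = (f ∘ v 1) ⬝ᵥ (f ∘ v 1) - 2 * f (u 1) ∧
      f (u k) ^ 2 * ((f ∘ r k) ⬝ᵥ (f ∘ r k)) = f m ^ 2 := by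
  simp only [orbitRelations, Set.mem_union, Set.mem_range, Set.mem_insert_iff,
    Set.mem_singleton_iff, or_imp, forall_and, forall_exists_index, forall_apply_eq_imp_iff,
    forall_eq, Pi.sub_apply, map_sub, map_mul, map_pow, map_crossProduct_apply,
    map_lenzVector_apply, RingHom.map_dotProduct, sub_eq_zero, map_ofNat, funext_iff, and_assoc]

/-- The nonzero constants form a multiplicative set; an ideal disjoint from it lies in a prime
disjoint from it. -/
theorem MvPolynomial.exists_C_mem_or_exists_prime {A σ : Type*} [CommRing A] [IsDomain A]
    (I : Ideal (MvPolynomial σ A)) :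
    (∃ a : A, a ≠ 0 ∧ C a ∈ I) ∨
      ∃ P : Ideal (MvPolynomial σ A), P.IsPrime ∧ I ≤ P ∧ ∀ a : A, C a ∈ P → a = 0 := by
  by_cases h : ∃ a : A, a ≠ 0 ∧ C a ∈ I
  · exact Or.inl h
  push Not at h
  obtain ⟨P, hP, hIP, hd⟩ := I.exists_le_prime_disjoint
    ((nonZeroDivisors A).map (C : A →+* MvPolynomial σ A)) (by
      rw [Set.disjoint_left]
      rintro _ hI ⟨a, ha, rfl⟩
      exact h a (nonZeroDivisors.ne_zero ha) hI)
  refine Or.inr ⟨P, hP, hIP, fun a ha => by_contra fun h0 => ?_⟩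
  exact Set.disjoint_left.1 hd ha ⟨a, mem_nonZeroDivisors_of_ne_zero h0, rfl⟩

/-- A solution of the equations of the linkage problem in a field makes the coordinates of the
data algebraically dependent. -/
theorem Attributable.not_injective_of_orbitRelations {F A B L : Type*} [Field F] [CommRing A]
    [CommRing B] [Field L] [Algebra F A] [Algebra F L] {m : F} (hm : m ≠ 0)
    {D : Fin 2 → Attributable A} (hα : ∀ j, (D j).cosα ^ 2 + (D j).sinα ^ 2 = 1)
    (hδ : ∀ j, (D j).cosδ ^ 2 + (D j).sinδ ^ 2 = 1) (hD : AlgebraicIndependent F (coordinates D))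
    (C : A →+* B) (f : B →+* L) (g : A →ₐ[F] L) (hfg : ∀ a, f (C a) = g a)
    {ρ ρdot u : Fin 2 → B} {k : Fin 2}
    (hzero : ∀ p ∈ orbitRelations (C (algebraMap F A m)) (fun j => ((D j).map C).pos (ρ j))
      (fun j => ((D j).map C).vel (ρ j) (ρdot j)) u k, f p = 0) :
    ¬ Function.Injective g := by
  intro hg
  obtain ⟨h1, h2, h3, h4⟩ := (forall_orbitRelations_map_eq_zero_iff f).1 hzero
  have hmap : ∀ j, ((D j).map C).map f = (D j).map (g : A →+* L) := fun j => by
    simp [map, hfg]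
  have hpos : ∀ j, f ∘ ((D j).map C).pos (ρ j) = ((D j).map (g : A →+* L)).pos (f (ρ j)) :=
    fun j => by
      rw [← hmap, comp_pos]
  have hvel : ∀ j, f ∘ ((D j).map C).vel (ρ j) (ρdot j) =
      ((D j).map (g : A →+* L)).vel (f (ρ j)) (f (ρdot j)) := fun j => by
    rw [← hmap, comp_vel]
  simp only [hpos, hvel] at h1 h2 h3 h4
  rw [hfg, AlgHom.commutes] at h4
  have h : SameOrbit (algebraMap F L m) (fun j => ((D j).map (g : A →+* L)).pos (f (ρ j)))
      (fun j => ((D j).map (g : A →+* L)).vel (f (ρ j)) (f (ρdot j))) (fun j => f (u j)) :=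
    SameOrbit.of_potential h1 h2 h3 k h4
  refine not_algebraicIndependent_of_sameOrbit hm (fun j => ?_) (fun j => ?_) h ?_
  · simpa [map] using congrArg g (hα j)
  · simpa [map] using congrArg g (hδ j)
  · rw [coordinates_map]
    exact hD.map' hg

theorem Attributable.exists_C_mem_span_orbitRelations {F A : Type*} [Field F] [CommRing A]
    [IsDomain A] [Algebra F A] {m : F} (hm : m ≠ 0) {D : Fin 2 → Attributable A}
    (hα : ∀ j, (D j).cosα ^ 2 + (D j).sinα ^ 2 = 1) (hδ : ∀ j, (D j).cosδ ^ 2 + (D j).sinδ ^ 2 = 1)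
    (hD : AlgebraicIndependent F (coordinates D)) {σ : Type*} (ρ ρdot u : Fin 2 → MvPolynomial σ A)
    (k : Fin 2) :
    ∃ a : A, a ≠ 0 ∧ MvPolynomial.C a ∈ Ideal.span (orbitRelations (MvPolynomial.C (algebraMap F A m))
      (fun j => ((D j).map MvPolynomial.C).pos (ρ j))
      (fun j => ((D j).map MvPolynomial.C).vel (ρ j) (ρdot j)) u k) := by
  refine (MvPolynomial.exists_C_mem_or_exists_prime _).resolve_right ?_
  rintro ⟨P, hP, hIP, hinj⟩
  -- The generic point of `P`: a solution over a field into which `A` embeds.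
  let f : MvPolynomial σ A →ₐ[F] FractionRing (MvPolynomial σ A ⧸ P) :=
    (IsScalarTower.toAlgHom F (MvPolynomial σ A ⧸ P) _).comp (Ideal.Quotient.mkₐ F P)
  have hf : ∀ p, f p = 0 ↔ p ∈ P := fun p => by
    rw [← Ideal.Quotient.eq_zero_iff_mem]
    exact IsFractionRing.to_map_eq_zero_iff (R := MvPolynomial σ A ⧸ P)
  refine not_injective_of_orbitRelations hm hα hδ hD MvPolynomial.C (f : _ →+* _)
    (f.comp (Algebra.algHom F A (MvPolynomial σ A))) (fun a => rfl)
    (fun p hp => (hf p).2 (hIP (Ideal.subset_span hp))) ?_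
  rw [injective_iff_map_eq_zero]
  exact fun a ha => hinj a ((hf _).1 ha)

/-- Over a domain of data whose coordinates are algebraically independent, the unknowns can be
eliminated from the equations of the linkage problem. -/
theorem Attributable.exists_eliminant {F A S : Type*} [Field F] [CommRing A] [CommRing S]
    [IsDomain A] [Algebra F A] {m : F} (hm : m ≠ 0) {D : Fin 2 → Attributable A}
    (hα : ∀ j, (D j).cosα ^ 2 + (D j).sinα ^ 2 = 1) (hδ : ∀ j, (D j).cosδ ^ 2 + (D j).sinδ ^ 2 = 1)
    (hD : AlgebraicIndependent F (coordinates D)) (k : Fin 2) :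
    ∃ a : A, a ≠ 0 ∧ ∀ (φ : A →+* S) (r v : Fin 2 → Fin 3 → S) (ρ ρdot u : Fin 2 → S),
      (∀ j, ((D j).map φ).pos (ρ j) = r j) → (∀ j, ((D j).map φ).vel (ρ j) (ρdot j) = v j) →
      r 0 ⨯₃ v 0 = r 1 ⨯₃ v 1 →
      lenzVector (r 0) (v 0) (u 0) = lenzVector (r 1) (v 1) (u 1) →
      v 0 ⬝ᵥ v 0 - 2 * u 0 = v 1 ⬝ᵥ v 1 - 2 * u 1 →
      u k ^ 2 * (r k ⬝ᵥ r k) = φ (algebraMap F A m) ^ 2 → φ a = 0 := by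
  obtain ⟨a, ha, hmem⟩ := exists_C_mem_span_orbitRelations hm hα hδ hD
    (σ := Fin 2 × Fin 3) (fun j => MvPolynomial.X (j, 0)) (fun j => MvPolynomial.X (j, 1))
    (fun j => MvPolynomial.X (j, 2)) k
  refine ⟨a, ha, fun φ r v ρ ρdot u hr hv hc hA hE hk => ?_⟩
  let ψ : MvPolynomial (Fin 2 × Fin 3) A →+* S :=
    MvPolynomial.eval₂Hom φ fun p => ![ρ p.1, ρdot p.1, u p.1] p.2
  have hψC : ∀ b, ψ (MvPolynomial.C b) = φ b := MvPolynomial.eval₂Hom_C _ _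
  have hψX : ∀ p, ψ (MvPolynomial.X p) = ![ρ p.1, ρdot p.1, u p.1] p.2 :=
    MvPolynomial.eval₂Hom_X' _ _
  have hmap : ∀ j, ((D j).map MvPolynomial.C).map ψ = (D j).map φ := fun j => by
    simp only [map, hψC]
  have hr' : ∀ j, ψ ∘ ((D j).map MvPolynomial.C).pos (MvPolynomial.X (j, 0)) = r j := fun j => by
    rw [comp_pos, hmap, hψX]
    exact hr j
  have hv' : ∀ j, ψ ∘ ((D j).map MvPolynomial.C).vel (MvPolynomial.X (j, 0))
      (MvPolynomial.X (j, 1)) = v j := fun j => by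
    rw [comp_vel, hmap, hψX, hψX]
    exact hv j
  have hu : ∀ j, ψ (MvPolynomial.X (j, 2)) = u j := fun j => hψX _
  -- Evaluation at a solution kills all generators, hence the constant in their span.
  have hspan := Ideal.span_le (I := RingHom.ker ψ) |>.2
    ((forall_orbitRelations_map_eq_zero_iff ψ).2 (by
      simp only [hr', hv', hu, hψC]
      exact ⟨hc, hA, hE, hk⟩)) hmem
  rw [← hψC]
  exact hspan

end Elimination

/-! ### The domain of analytic functions on the data space. -/

section AnalyticData

/-- The real analytic functions on a normed space. -/
def analyticSubalgebra (E : Type*) [NormedAddCommGroup E] [NormedSpace ℝ E] :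
    Subalgebra ℝ (E → ℝ) where
  carrier := {f | AnalyticOnNhd ℝ f Set.univ}
  mul_mem' hf hg := hf.mul hg
  add_mem' hf hg := hf.add hg
  algebraMap_mem' c := analyticOnNhd_const (v := c)

instance (E : Type*) [NormedAddCommGroup E] [NormedSpace ℝ E] :
    IsDomain (analyticSubalgebra E) := by
  have : NoZeroDivisors (analyticSubalgebra E) := by
    refine ⟨fun {f g} hfg => or_iff_not_imp_left.2 fun hf => ?_⟩
    have hfg' : ∀ x, f.1 x * g.1 x = 0 := fun x => congrFun (congrArg Subtype.val hfg) x
    obtain ⟨x, hx⟩ : ∃ x, f.1 x ≠ 0 := Function.ne_iff.1 fun h => hf (Subtype.ext h)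
    -- Where `f` is nonzero it stays nonzero nearby, so `g` vanishes on an open set and the identity
    -- theorem applies.
    refine Subtype.ext (AnalyticOnNhd.eq_of_eventuallyEq g.2
      (analyticOnNhd_const (v := (0 : ℝ))) (z₀ := x) ?_)
    filter_upwards [((f.2 x trivial).continuousAt).eventually_ne hx] with y hy
    exact (mul_eq_zero.1 (hfg' y)).resolve_left hy
  exact NoZeroDivisors.to_isDomain _

theorem analyticAt_angles (j : Fin 2) (i : Fin 4) (d : LinkData) :
    AnalyticAt ℝ (fun d : LinkData => (d j).1 i) d :=
  ((ContinuousLinearMap.proj (R := ℝ) (φ := fun _ : Fin 4 => ℝ) i).comp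
    ((ContinuousLinearMap.fst ℝ _ _).comp
      (ContinuousLinearMap.proj (R := ℝ) (φ := fun _ : Fin 2 => EpochData) j))).analyticAt d

theorem analyticAt_position (j : Fin 2) (i : Fin 3) (d : LinkData) :
    AnalyticAt ℝ (fun d : LinkData => (d j).2.1 i) d :=
  ((ContinuousLinearMap.proj (R := ℝ) (φ := fun _ : Fin 3 => ℝ) i).comp
    ((ContinuousLinearMap.fst ℝ _ _).comp ((ContinuousLinearMap.snd ℝ _ _).comp
      (ContinuousLinearMap.proj (R := ℝ) (φ := fun _ : Fin 2 => EpochData) j)))).analyticAt d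

theorem analyticAt_velocity (j : Fin 2) (i : Fin 3) (d : LinkData) :
    AnalyticAt ℝ (fun d : LinkData => (d j).2.2 i) d :=
  ((ContinuousLinearMap.proj (R := ℝ) (φ := fun _ : Fin 3 => ℝ) i).comp
    ((ContinuousLinearMap.snd ℝ _ _).comp ((ContinuousLinearMap.snd ℝ _ _).comp
      (ContinuousLinearMap.proj (R := ℝ) (φ := fun _ : Fin 2 => EpochData) j)))).analyticAt d

/-- The data of the linkage problem as analytic functions on the data space. -/
noncomputable def analyticData (j : Fin 2) : Attributable (analyticSubalgebra LinkData) where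
  cosα := ⟨fun d => Real.cos (d j).α, fun d _ => Real.analyticAt_cos.comp (analyticAt_angles j 0 d)⟩
  sinα := ⟨fun d => Real.sin (d j).α, fun d _ => Real.analyticAt_sin.comp (analyticAt_angles j 0 d)⟩
  cosδ := ⟨fun d => Real.cos (d j).δ, fun d _ => Real.analyticAt_cos.comp (analyticAt_angles j 1 d)⟩
  sinδ := ⟨fun d => Real.sin (d j).δ, fun d _ => Real.analyticAt_sin.comp (analyticAt_angles j 1 d)⟩
  αdot := ⟨fun d => (d j).αdot, fun d _ => analyticAt_angles j 2 d⟩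
  δdot := ⟨fun d => (d j).δdot, fun d _ => analyticAt_angles j 3 d⟩
  q i := ⟨fun d => (d j).q i, fun d _ => analyticAt_position j i d⟩
  qdot i := ⟨fun d => (d j).qdot i, fun d _ => analyticAt_velocity j i d⟩

/-- Evaluation of an analytic function on the data space at a point, with values in `ℂ`. -/
noncomputable def evalData (d : LinkData) : analyticSubalgebra LinkData →+* ℂ :=
  Complex.ofRealHom.comp ((Pi.evalRingHom (fun _ : LinkData => ℝ) d).comp
    (analyticSubalgebra LinkData).val.toRingHom)

theorem evalData_apply (d : LinkData) (f : analyticSubalgebra LinkData) :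
    evalData d f = (f.1 d : ℂ) :=
  rfl

theorem algebraicIndependent_coordinates_analyticData :
    AlgebraicIndependent ℝ (Attributable.coordinates analyticData) := by
  rw [algebraicIndependent_iff]
  intro p hp
  -- Each point of this box is a value of the coordinates, with `Real.arcsin` supplying the angles;
  -- a polynomial vanishing on a product of infinite sets is zero.
  let s : Fin 2 × (Fin 4 ⊕ Fin 3 ⊕ Fin 3) → Set ℝ := fun _ => Set.Icc (-1) 1
  refine MvPolynomial.funext_set s (fun _ => Set.Icc_infinite (by norm_num)) fun y hy => ?_
  let d : LinkData := fun j => (![Real.arcsin (y (j, Sum.inl 0)), Real.arcsin (y (j, Sum.inl 1)),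
    y (j, Sum.inl 2), y (j, Sum.inl 3)], fun i => y (j, Sum.inr (Sum.inl i)),
    fun i => y (j, Sum.inr (Sum.inr i)))
  let ev : analyticSubalgebra LinkData →ₐ[ℝ] ℝ :=
    (Pi.evalAlgHom ℝ (fun _ : LinkData => ℝ) d).comp (analyticSubalgebra LinkData).val
  have hy' : ∀ i, -1 ≤ y i ∧ y i ≤ 1 := fun i => hy i trivial
  have hev : ev ∘ Attributable.coordinates analyticData = y := by
    funext p
    obtain ⟨j, i | i | i⟩ := p
    · fin_cases i
      · exact Real.sin_arcsin (hy' _).1 (hy' _).2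
      · exact Real.sin_arcsin (hy' _).1 (hy' _).2
      · rfl
      · rfl
    · rfl
    · rfl
  have h := congrArg ev hp
  rw [map_zero, MvPolynomial.comp_aeval_apply, ← Function.comp_def, hev] at h
  simpa [MvPolynomial.aeval_eq_eval] using h

theorem map_evalData_pos (d : LinkData) (x : LinkUnknowns) (j : Fin 2) :
    ((analyticData j).map (evalData d)).pos (x.ρ j) = x.r d j := by
  funext i
  fin_cases i <;> simp [Attributable.pos, Attributable.eρ, Attributable.map, analyticData,
    evalData_apply, LinkUnknowns.r, complexify, EpochData.eρ]

theorem map_evalData_vel (d : LinkData) (x : LinkUnknowns) (j : Fin 2) :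
    ((analyticData j).map (evalData d)).vel (x.ρ j) (x.ρdot j) = x.rdot d j := by
  funext i
  fin_cases i <;> simp [Attributable.vel, Attributable.eρ, Attributable.η, Attributable.map,
    analyticData, evalData_apply, LinkUnknowns.rdot, complexify, EpochData.eρ, EpochData.η,
    EpochData.eα, EpochData.eδ, sub_eq_add_neg]

theorem forGenericData_not_reducedSystemConsistent {μ : ℝ} (hμ : 0 < μ) (k : Fin 2) :
    ForGenericData (fun d => ¬ ReducedSystemConsistent μ k d) := by
  obtain ⟨a, ha, h⟩ := Attributable.exists_eliminant (S := ℂ) (D := analyticData) hμ.ne'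
    (fun j => Subtype.ext (funext fun d => Real.cos_sq_add_sin_sq (d j).α))
    (fun j => Subtype.ext (funext fun d => Real.cos_sq_add_sin_sq (d j).δ))
    algebraicIndependent_coordinates_analyticData k
  refine ⟨a.1, a.2, Function.ne_iff.1 fun h => ha (Subtype.ext h), ?_⟩
  rintro d hd ⟨x, ⟨hc, hA, hE⟩, hk⟩
  refine hd (Complex.ofReal_eq_zero.1 (h (evalData d) (x.r d) (x.rdot d) x.ρ x.ρdot x.u
    (map_evalData_pos d x) (map_evalData_vel d x) hc hA ?_ hk))
  rw [LinkUnknowns.energy, LinkUnknowns.energy] at hE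
  linear_combination 2 * hE

end AnalyticData

theorem mainTheorem3 (μ : ℝ) (hμ : 0 < μ) :
    ForGenericData (fun d => ¬ FullSystemConsistent μ d) ∧
      ∀ j : Fin 2, ForGenericData (fun d => ¬ ReducedSystemConsistent μ j d) := by
  have h := fun j => forGenericData_not_reducedSystemConsistent hμ j
  refine ⟨?_, h⟩
  -- The full system contains the reduced one, so either epoch's function would do.
  obtain ⟨G, hG, hne, hP⟩ := h 0
  exact ⟨G, hG, hne, fun d hd ⟨x, hx, hu⟩ => hP d hd ⟨x, hx, hu 0⟩⟩
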